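/- Let $A$ be a Noetherian local integrally closed domain with maximal ideal $\mathfrak{m}$ and fraction field $K$. Let $f\in K[x]$ be a monic, irreducible and separable polynomial, let $L=K[x]/(f)$, and let $\overline{L}$ be a splitting field of $f$ over $K$ (so that $\overline{L}$ is a Galois closure of $L/K$), with Galois group $G=\mathrm{Gal}(\overline{L}/K)$. Let $B$ and $\overline{B}$ be the integral closures of $A$ in $L$ and in $\overline{L}$, let $\overline{\mathfrak{m}}$ be a prime ideal of $\overline{B}$ lying above $\mathfrak{m}$, and let $D_{\overline{\mathfrak{m}}}=\{\sigma\in G:\sigma(\overline{\mathfrak{m}})=\overline{\mathfrak{m}}\}$ be its decomposition group. For a root $\alpha_i\in\overline{L}$ of $f$, let $\phi_i:L\to\overline{L}$ be the $K$-embedding that sends the class of $x$ to $\alpha_i$, and let $\phi_i^{-1}(\overline{\mathfrak{m}})$ denote the ideal of all $b\in B$ with $\phi_i(b)\in\overline{\mathfrak{m}}$. Then $$D_{\overline{\mathfrak{m}}}\,\alpha_i\;\longmapsto\;\mathfrak{m}_i:=\phi_i^{-1}(\overline{\mathfrak{m}})$$ is a well-defined bijection from the set of orbits of $D_{\overline{\mathfrak{m}}}$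 on the roots of $f$ in $\overline{L}$ to the set of prime ideals of $B$ lying above $\mathfrak{m}$. -/

import Mathlib

open Polynomial
open scoped Pointwise

noncomputable section

/-- The `K`-embedding `L → Ω` attached to a root `β ∈ Ω` of `f`, where `L = K[x]/(f)`:
it sends the class of `x` to `β`. -/
def rootEmbedding {K L Ω : Type*} [Field K] [Field L] [Field Ω] [Algebra K L] [Algebra K Ω]
    {f : K[X]} (h : IsAdjoinRoot L f) (β : f.rootSet Ω) : L →ₐ[K] Ω :=
  h.liftHom (β : Ω) (aeval_eq_zero_of_mem_rootSet β.2)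

theorem rootEmbedding_root {K L Ω : Type*} [Field K] [Field L] [Field Ω] [Algebra K L]
    [Algebra K Ω] {f : K[X]} (h : IsAdjoinRoot L f) (β : f.rootSet Ω) :
    rootEmbedding h β h.root = β :=
  h.liftHom_root _

/-- It is the only such embedding. -/
theorem eq_rootEmbedding {K L Ω : Type*} [Field K] [Field L] [Field Ω] [Algebra K L]
    [Algebra K Ω] {f : K[X]} (h : IsAdjoinRoot L f) (β : f.rootSet Ω) (φ : L →ₐ[K] Ω)
    (hφ : φ h.root = β) : φ = rootEmbedding h β :=
  h.eq_liftHom _ φ hφ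

/-- The preimage `φ⁻¹(M)`, an ideal of the integral closure of `A` in `L`, of an ideal `M` of the
integral closure of `A` in `Ω` under a `K`-embedding `φ : L → Ω`. -/
def preimageIdeal (A : Type*) {K L Ω : Type*} [CommRing A] [Field K] [Field L] [Field Ω]
    [Algebra A K] [Algebra K L] [Algebra K Ω] [Algebra A L] [Algebra A Ω]
    [IsScalarTower A K L] [IsScalarTower A K Ω] (φ : L →ₐ[K] Ω)
    (M : Ideal (integralClosure A Ω)) : Ideal (integralClosure A L) :=
  M.comap (φ.restrictScalars A).mapIntegralClosure

theorem mem_preimageIdeal (A : Type*) {K L Ω : Type*} [CommRing A] [Field K] [Field L] [Field Ω]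
    [Algebra A K] [Algebra K L] [Algebra K Ω] [Algebra A L] [Algebra A Ω]
    [IsScalarTower A K L] [IsScalarTower A K Ω] (φ : L →ₐ[K] Ω)
    (M : Ideal (integralClosure A Ω)) (b : integralClosure A L) :
    b ∈ preimageIdeal A φ M ↔ ∃ c ∈ M, (c : Ω) = φ b :=
  ⟨fun hb => ⟨_, hb, rfl⟩, fun ⟨c, hc, e⟩ => by
    have : c = (φ.restrictScalars A).mapIntegralClosure b := Subtype.ext e
    subst this
    exact hc⟩

/-- The decomposition group `{σ ∈ Gal(Ω/K) : σ(M) = M}` of an ideal `M` of the integral closure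
of `A` in `Ω`, the Galois group acting on this integral closure by restriction. -/
def decompositionGroup (A K : Type*) {Ω : Type*} [CommRing A] [Field K] [Field Ω]
    [Algebra A K] [Algebra K Ω] [Algebra A Ω] [IsScalarTower A K Ω]
    (M : Ideal (integralClosure A Ω)) : Subgroup (Ω ≃ₐ[K] Ω) :=
  MulAction.stabilizer (Ω ≃ₐ[K] Ω) M

theorem mem_decompositionGroup (A K : Type*) {Ω : Type*} [CommRing A] [Field K] [Field Ω]
    [Algebra A K] [Algebra K Ω] [Algebra A Ω] [IsScalarTower A K Ω]
    (M : Ideal (integralClosure A Ω)) (σ : Ω ≃ₐ[K] Ω) :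
    σ ∈ decompositionGroup A K M ↔
      M.map ((σ : Ω →ₐ[K] Ω).restrictScalars A).mapIntegralClosure = M :=
  Iff.rfl

end

/-! The Galois group `G` acts transitively both on the roots of `f` and on the primes of the upper
ring over the maximal ideal. Replacing a root `β` by `σ • β` has the same effect on the preimage as
replacing `M` by `σ⁻¹ • M` (`preimageIdeal_comp`, `rootEmbedding_smul`). Surjectivity is then lying
over plus transitivity on primes. Injectivity uses transitivity a second time, over `L`: primes with
the same preimage under `φ` are conjugate under the automorphisms fixing `φ(L)`, hence fixing the
root (`exists_algEquiv_smul_eq_of_preimageIdeal_eq`). -/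

theorem mem_preimageIdeal_iff (A : Type*) {K L Ω : Type*} [CommRing A] [Field K] [Field L]
    [Field Ω] [Algebra A K] [Algebra K L] [Algebra K Ω] [Algebra A L] [Algebra A Ω]
    [IsScalarTower A K L] [IsScalarTower A K Ω] (φ : L →ₐ[K] Ω)
    (M : Ideal (integralClosure A Ω)) (b : integralClosure A L) :
    b ∈ preimageIdeal A φ M ↔ (φ.restrictScalars A).mapIntegralClosure b ∈ M :=
  Iff.rfl

theorem preimageIdeal_comp (A : Type*) {K L Ω : Type*} [CommRing A] [Field K] [Field L]
    [Field Ω] [Algebra A K] [Algebra K L] [Algebra K Ω] [Algebra A L] [Algebra A Ω]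
    [IsScalarTower A K L] [IsScalarTower A K Ω] (σ : Ω ≃ₐ[K] Ω) (φ : L →ₐ[K] Ω)
    (M : Ideal (integralClosure A Ω)) :
    preimageIdeal A ((σ : Ω →ₐ[K] Ω).comp φ) M = preimageIdeal A φ (σ⁻¹ • M) := by
  ext b
  rw [mem_preimageIdeal_iff, mem_preimageIdeal_iff, Ideal.mem_inv_pointwise_smul_iff]
  rfl

/-- The automorphisms over the image of an embedding `φ : L → Ω` act transitively on the primes
of the integral closure in `Ω` with a given preimage under `φ`. -/
theorem exists_algEquiv_smul_eq_of_preimageIdeal_eq {A K L Ω : Type*} [CommRing A] [Field K]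
    [Field L] [Field Ω] [Algebra A K] [Algebra K L] [Algebra K Ω] [Algebra A L] [Algebra A Ω]
    [IsScalarTower A K L] [IsScalarTower A K Ω] [FiniteDimensional K Ω] [IsGalois K Ω]
    (φ : L →ₐ[K] Ω) (M N : Ideal (integralClosure A Ω)) [M.IsPrime] [N.IsPrime]
    (h : preimageIdeal A φ M = preimageIdeal A φ N) :
    ∃ τ : Ω ≃ₐ[K] Ω, (τ : Ω →ₐ[K] Ω).comp φ = φ ∧ N = τ • M := by
  -- With this algebra structure, preimage under `φ` is contraction by definition, so `h` can be
  -- used directly as an equality of contractions.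
  let : Algebra (integralClosure A L) (integralClosure A Ω) :=
    (φ.restrictScalars A).mapIntegralClosure.toAlgebra
  have hcoe (b : integralClosure A L) :
      ((algebraMap (integralClosure A L) (integralClosure A Ω) b : integralClosure A Ω) : Ω) =
        φ b := rfl
  let H : Subgroup (Ω ≃ₐ[K] Ω) := φ.fieldRange.fixingSubgroup
  have hfix (g : H) (x : L) : (g : Ω ≃ₐ[K] Ω) (φ x) = φ x :=
    (IntermediateField.mem_fixingSubgroup_iff _ _).mp g.2 _ ⟨x, rfl⟩
  have : SMulCommClass H (integralClosure A L) (integralClosure A Ω) := by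
    refine ⟨fun g b c ↦ Subtype.ext ?_⟩
    rw [Algebra.smul_def, Algebra.smul_def]
    change (g : Ω ≃ₐ[K] Ω) (φ b * c) = φ b * (g : Ω ≃ₐ[K] Ω) c
    rw [map_mul, hfix]
  have : Algebra.IsInvariant (integralClosure A L) (integralClosure A Ω) H := by
    refine ⟨fun x hx ↦ ?_⟩
    -- By the Galois correspondence the fixed field of `H` is `φ(L)`; integrality over `A` then
    -- descends along the injective `φ`.
    have hx' : (x : Ω) ∈ IntermediateField.fixedField H := fun g ↦
      congrArg (Subtype.val : integralClosure A Ω → Ω) (hx g)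
    rw [IsGalois.fixedField_fixingSubgroup] at hx'
    obtain ⟨y, hy⟩ := hx'
    have hy' : φ.restrictScalars A y = x := hy
    have hint : IsIntegral A y := by
      rw [← isIntegral_algHom_iff (φ.restrictScalars A) φ.injective, hy']
      exact x.2
    exact ⟨⟨y, hint⟩, Subtype.ext hy⟩
  obtain ⟨g, hg⟩ := Algebra.IsInvariant.exists_smul_of_under_eq
    (integralClosure A L) (integralClosure A Ω) H M N h
  exact ⟨g, AlgHom.ext (hfix g), hg⟩

/-- The Galois group acts transitively on the primes of the integral closure of an integrally
closed domain over a given prime. -/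
theorem exists_algEquiv_smul_eq_of_under_eq {A K Ω : Type*} [CommRing A] [IsDomain A]
    [IsIntegrallyClosed A] [Field K] [Algebra A K] [IsFractionRing A K] [Field Ω] [Algebra K Ω]
    [Algebra A Ω] [IsScalarTower A K Ω] [FiniteDimensional K Ω] [IsGalois K Ω]
    (M N : Ideal (integralClosure A Ω)) [M.IsPrime] [N.IsPrime] (h : M.under A = N.under A) :
    ∃ τ : Ω ≃ₐ[K] Ω, N = τ • M := by
  -- The case `L = K`: since `A` is integrally closed, its integral closure in `K` is `A` itself.
  obtain ⟨τ, -, hτ⟩ := exists_algEquiv_smul_eq_of_preimageIdeal_eq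
    (Algebra.ofId K Ω) M N (by
      ext b
      obtain ⟨a, ha⟩ := (IsIntegrallyClosed.isIntegral_iff (R := A)).mp b.2
      obtain rfl : algebraMap A (integralClosure A K) a = b := Subtype.ext ha
      rw [mem_preimageIdeal_iff, mem_preimageIdeal_iff, AlgHom.commutes, ← Ideal.mem_comap,
        ← Ideal.mem_comap]
      exact SetLike.ext_iff.mp h a)
  exact ⟨τ, hτ⟩

theorem preimageIdeal_mem_primesOver {A K L Ω : Type*} [CommRing A] [Field K] [Field L] [Field Ω]
    [Algebra A K] [Algebra K L] [Algebra K Ω] [Algebra A L] [Algebra A Ω]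
    [IsScalarTower A K L] [IsScalarTower A K Ω] (φ : L →ₐ[K] Ω) (p : Ideal A)
    (M : Ideal (integralClosure A Ω)) [M.IsPrime] [M.LiesOver p] :
    preimageIdeal A φ M ∈ p.primesOver (integralClosure A L) := by
  refine ⟨Ideal.comap_isPrime _ M, ⟨?_⟩⟩
  rw [M.over_def p]
  ext a
  rw [Ideal.under_def, Ideal.under_def, Ideal.mem_comap, Ideal.mem_comap, mem_preimageIdeal_iff,
    AlgHom.commutes]

/-- Lying over for an embedding of integral closures. -/
theorem exists_isPrime_preimageIdeal_eq {A K L Ω : Type*} [CommRing A] [Field K] [Field L]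
    [Field Ω] [Algebra A K] [Algebra K L] [Algebra K Ω] [Algebra A L] [Algebra A Ω]
    [IsScalarTower A K L] [IsScalarTower A K Ω] (φ : L →ₐ[K] Ω)
    (Q : Ideal (integralClosure A L)) [Q.IsPrime] :
    ∃ N : Ideal (integralClosure A Ω), N.IsPrime ∧ preimageIdeal A φ N = Q := by
  algebraize [(φ.restrictScalars A).mapIntegralClosure.toRingHom]
  have : IsScalarTower A (integralClosure A L) (integralClosure A Ω) :=
    .of_algebraMap_eq fun a ↦ ((φ.restrictScalars A).mapIntegralClosure.commutes a).symm
  have : Algebra.IsIntegral (integralClosure A L) (integralClosure A Ω) :=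
    Algebra.IsIntegral.tower_top A
  obtain ⟨N, hN, hQ⟩ := Ideal.exists_ideal_over_prime_of_isIntegral_of_isDomain
    (S := integralClosure A Ω) Q (by
      rw [(RingHom.injective_iff_ker_eq_bot _).mp fun b c hbc ↦ Subtype.ext (φ.injective
        (congrArg (Subtype.val : integralClosure A Ω → Ω) hbc))]
      exact bot_le)
  exact ⟨N, hN, hQ⟩

theorem rootEmbedding_smul {K L Ω : Type*} [Field K] [Field L] [Field Ω] [Algebra K L]
    [Algebra K Ω] {f : K[X]} (h : IsAdjoinRoot L f) (σ : Ω ≃ₐ[K] Ω) (β : f.rootSet Ω) :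
    rootEmbedding h (σ • β) = (σ : Ω →ₐ[K] Ω).comp (rootEmbedding h β) := by
  refine (eq_rootEmbedding h _ _ ?_).symm
  rw [AlgHom.comp_apply, rootEmbedding_root]
  rfl

theorem exists_smul_eq_of_mem_rootSet {K Ω : Type*} [Field K] [Field Ω] [Algebra K Ω] [Normal K Ω]
    {f : K[X]} (hf_monic : f.Monic) (hf_irr : Irreducible f) (β γ : f.rootSet Ω) :
    ∃ σ : Ω ≃ₐ[K] Ω, σ • β = γ := by
  have hmin (δ : f.rootSet Ω) : minpoly K (δ : Ω) = f :=
    (minpoly.eq_of_irreducible_of_monic hf_irr (aeval_eq_zero_of_mem_rootSet δ.2) hf_monic).symm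
  obtain ⟨σ, hσ⟩ := (Normal.minpoly_eq_iff_mem_orbit Ω).mp ((hmin γ).trans (hmin β).symm)
  exact ⟨σ, Subtype.ext hσ⟩

/-- Two roots give the same preimage of `M` if and only if they are conjugate under the
decomposition group of `M`. -/
theorem preimageIdeal_rootEmbedding_eq_iff {A K L Ω : Type*} [CommRing A] [Field K] [Algebra A K]
    {f : K[X]} (hf_monic : f.Monic) (hf_irr : Irreducible f)
    [Field L] [Algebra K L] [Algebra A L] [IsScalarTower A K L] (hL : IsAdjoinRoot L f)
    [Field Ω] [Algebra K Ω] [Algebra A Ω] [IsScalarTower A K Ω] [FiniteDimensional K Ω]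
    [IsGalois K Ω] (M : Ideal (integralClosure A Ω)) [M.IsPrime] (β γ : f.rootSet Ω) :
    preimageIdeal A (rootEmbedding hL β) M = preimageIdeal A (rootEmbedding hL γ) M ↔
      MulAction.orbitRel (decompositionGroup A K M) (f.rootSet Ω) β γ := by
  rw [MulAction.orbitRel_apply, MulAction.mem_orbit_iff]
  constructor
  · intro h
    obtain ⟨σ, rfl⟩ := exists_smul_eq_of_mem_rootSet hf_monic hf_irr γ β
    rw [rootEmbedding_smul, preimageIdeal_comp] at h
    have : (σ⁻¹ • M).IsPrime := Ideal.IsPrime.smul σ⁻¹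
    obtain ⟨τ, hτ, hM⟩ := exists_algEquiv_smul_eq_of_preimageIdeal_eq _ _ _ h.symm
    -- Here `σ⁻¹ • M = τ • M` and `τ` fixes `γ`, so `σ * τ` stabilizes `M` and still sends `γ` to `σ
    -- • γ`.
    refine ⟨⟨σ * τ, ?_⟩, ?_⟩
    · rw [decompositionGroup, MulAction.mem_stabilizer_iff, mul_smul, ← hM, smul_inv_smul]
    · have hτγ : τ • γ = γ := by
        refine Subtype.ext ?_
        change (τ : Ω →ₐ[K] Ω) γ = γ
        simpa only [AlgHom.comp_apply, rootEmbedding_root] using DFunLike.congr_fun hτ hL.root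
      change (σ * τ) • γ = σ • γ
      rw [mul_smul, hτγ]
  · rintro ⟨⟨σ, hσ⟩, rfl⟩
    change preimageIdeal A (rootEmbedding hL (σ • γ)) M = _
    rw [rootEmbedding_smul, preimageIdeal_comp, MulAction.mem_stabilizer_iff.mp (inv_mem hσ)]

theorem exists_preimageIdeal_rootEmbedding_eq {A K L Ω : Type*} [CommRing A] [IsDomain A]
    [IsIntegrallyClosed A] [Field K] [Algebra A K] [IsFractionRing A K] {f : K[X]}
    [Field L] [Algebra K L] [Algebra A L] [IsScalarTower A K L] (hL : IsAdjoinRoot L f)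
    [Field Ω] [Algebra K Ω] [Algebra A Ω] [IsScalarTower A K Ω] [FiniteDimensional K Ω]
    [IsGalois K Ω] [Nonempty (f.rootSet Ω)] (p : Ideal A)
    (M : Ideal (integralClosure A Ω)) [M.IsPrime] [M.LiesOver p]
    (Q : Ideal (integralClosure A L)) [Q.IsPrime] [Q.LiesOver p] :
    ∃ β : f.rootSet Ω, preimageIdeal A (rootEmbedding hL β) M = Q := by
  obtain ⟨β⟩ := ‹Nonempty (f.rootSet Ω)›
  obtain ⟨N, hN, rfl⟩ := exists_isPrime_preimageIdeal_eq (rootEmbedding hL β) Q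
  have : N.LiesOver (N.under A) := ⟨rfl⟩
  have hNp : N.under A = p := by
    rw [Ideal.over_def (preimageIdeal A (rootEmbedding hL β) N) p]
    exact (preimageIdeal_mem_primesOver (rootEmbedding hL β) (N.under A) N).2.over
  obtain ⟨τ, rfl⟩ := exists_algEquiv_smul_eq_of_under_eq (K := K) M N
    ((M.over_def p).symm.trans hNp.symm)
  -- The prime `τ • M` lies over `Q` through `β`; moving `τ` from the prime to the root inverts it.
  refine ⟨τ⁻¹ • β, ?_⟩
  rw [rootEmbedding_smul, preimageIdeal_comp, inv_inv]

theorem mainTheorem4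
    {A K L Ω : Type*} [CommRing A] [IsDomain A] [IsLocalRing A] [IsNoetherianRing A]
    [IsIntegrallyClosed A]
    [Field K] [Algebra A K] [IsFractionRing A K]
    (f : K[X]) (hf_monic : f.Monic) (hf_irr : Irreducible f) (hf_sep : f.Separable)
    [Field L] [Algebra K L] [Algebra A L] [IsScalarTower A K L]
    (hL : IsAdjoinRoot L f)
    [Field Ω] [Algebra K Ω] [Algebra A Ω] [IsScalarTower A K Ω] [f.IsSplittingField K Ω]
    (M : Ideal (integralClosure A Ω)) [M.IsPrime] [M.LiesOver (IsLocalRing.maximalIdeal A)] :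
    ∃ e : MulAction.orbitRel.Quotient (decompositionGroup A K M) (f.rootSet Ω) ≃
        (IsLocalRing.maximalIdeal A).primesOver (integralClosure A L),
      ∀ β : f.rootSet Ω,
        (e (Quotient.mk (MulAction.orbitRel (decompositionGroup A K M) (f.rootSet Ω)) β) :
          Ideal (integralClosure A L)) = preimageIdeal A (rootEmbedding hL β) M := by
  have : FiniteDimensional K Ω := IsSplittingField.finiteDimensional Ω f
  have : IsGalois K Ω := IsGalois.of_separable_splitting_field hf_sep
  have : Nonempty (f.rootSet Ω) := by
    obtain ⟨x, hx⟩ := (IsSplittingField.splits Ω f).exists_eval_eq_zero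
      (by rw [degree_map]; exact hf_irr.degree_pos.ne')
    exact ⟨x, (mem_rootSet_of_ne hf_irr.ne_zero).mpr (by rwa [← eval_map_algebraMap])⟩
  let F : MulAction.orbitRel.Quotient (decompositionGroup A K M) (f.rootSet Ω) →
      (IsLocalRing.maximalIdeal A).primesOver (integralClosure A L) :=
    Quotient.lift
      (fun β ↦ ⟨preimageIdeal A (rootEmbedding hL β) M, preimageIdeal_mem_primesOver _ _ M⟩)
      fun β γ h ↦ Subtype.ext
        ((preimageIdeal_rootEmbedding_eq_iff hf_monic hf_irr hL M β γ).mpr h)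
  have hF : Function.Bijective F := by
    constructor
    · rintro ⟨β⟩ ⟨γ⟩ h
      exact Quotient.sound ((preimageIdeal_rootEmbedding_eq_iff hf_monic hf_irr hL M β γ).mp
        (congrArg Subtype.val h))
    · rintro ⟨Q, hQ, hQm⟩
      obtain ⟨β, hβ⟩ := exists_preimageIdeal_rootEmbedding_eq hL (IsLocalRing.maximalIdeal A) M Q
      exact ⟨Quotient.mk _ β, Subtype.ext hβ⟩
  exact ⟨Equiv.ofBijective F hF, fun β ↦ rfl⟩
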